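/- Throughout, $n\ge 1$ and all matrices are real $n\times n$ matrices with rows and columns indexed by $\langle n\rangle=\{1,\dots,n\}$. A matrix $X$ is an M-matrix if $X=\alpha I-P$ with $P$ entrywise nonnegative and $\alpha\in\mathbb R$ at least the spectral radius of $P$. The directed graph $\mathcal G(X)$ has vertex set $\langle n\rangle$ and an edge $(i,j)$ whenever $x_{ij}\neq 0$; $i$ has access to $j$ (and $j$ is accessed from $i$) if there is a path, possibly empty, from $i$ to $j$. The classes of $X$ are the equivalence classes of the relation "$i$ and $j$ have access to each other in $\mathcal G(X)$"; a class $J$ is singular if the principal submatrix $X_{JJ}$ is singular. For a nonempty $J\subseteq\langle n\rangle$ let $J^+=\{l : l>\max J\}$. An order preserving partition of $\langle n\rangle$ is a partition $(\upsilon_1,\dots,\upsilon_r)$ into nonempty blocks such that $i<j$, $i\in\upsilon_k$, $j\in\upsilon_{k'}$ imply $k\le k'$. The block lower triangular self-partition of $X$ is the finest (greatest lower bound with respect to refinement) of the order preserving partitions with $X_{\upsilon_i\,\upsilon_i^+}=0$ for all $i$; the block upper triangular self-partition of $X$ is the finest of the order preserving partitions with $X_{\upsilon_i^+\,\upsilon_i}=0$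 for all $i$. For a matrix $A$ let $S_1,\dots,S_m$ be its singular classes, ordered so that $\max S_i<\max S_{i+1}$, let $\mu_i=\max S_i$, and put $$F_i=\{l\ge\mu_i : \text{some } j\ge l \text{ is accessed from a vertex of } S_i \text{ in } \mathcal G(A)\},$$ $$T_i=\{l\ge\mu_i : \text{some } j\ge l \text{ has access to a vertex of } S_i \text{ in } \mathcal G(A)\}.$$ **Theorem (Minimality).** Let $A$ be an M-matrix with a factorization $A=LU$ where $L$ and $U$ are M-matrices. Then for every $i\in\{1,\dots,m\}$ there is a $Q_i\subseteq S_i$ such that $Q_i$ is a singular class of $L$ or of $U$. Moreover, for every $Q_i\subseteq S_i$: if $Q_i$ is a singular class of $L$, then $F_i$ is contained in a single block of the block lower triangular self-partition of $L$; if $Q_i$ is a singular class of $U$, then $T_i$ is contained in a single block of the block upper triangular self-partition of $U$. -/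

import Mathlib

namespace BlockLU

open Finset

variable {n : ℕ}

/-- `X` is an M-matrix: `X = α I - P` with `P` entrywise nonnegative and `α ≥ ρ(P)`, where `ρ(P)` is
the spectral radius over `ℂ`. The clause `0 ≤ α` is part of `α ≥ ρ(P)`, which `ENNReal.ofReal`
would lose for negative `α`. -/
def IsMMatrix (X : Matrix (Fin n) (Fin n) ℝ) : Prop :=
  ∃ (α : ℝ) (P : Matrix (Fin n) (Fin n) ℝ),
    (∀ i j, 0 ≤ P i j) ∧ X = α • (1 : Matrix (Fin n) (Fin n) ℝ) - P ∧
    0 ≤ α ∧ spectralRadius ℂ (P.map Complex.ofReal) ≤ ENNReal.ofReal α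

/-- The directed graph of `X`: there is an edge `(i, j)` iff `X i j ≠ 0` (loops allowed). -/
def digraph (X : Matrix (Fin n) (Fin n) ℝ) : Digraph (Fin n) where
  Adj i j := X i j ≠ 0

/-- `i` has access to `j` in the directed graph of `X`: there is a (possibly empty) path
from `i` to `j`. -/
def Access (X : Matrix (Fin n) (Fin n) ℝ) (i j : Fin n) : Prop :=
  Relation.ReflTransGen (digraph X).Adj i j

/-- `J` is a class of (the directed graph of) `X`: an equivalence class of the
communication relation. -/
def IsClass (X : Matrix (Fin n) (Fin n) ℝ) (J : Finset (Fin n)) : Prop :=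
  ∃ i, ∀ j, j ∈ J ↔ Access X i j ∧ Access X j i

/-- `J` is a singular class of `X`: a class such that the principal submatrix `X_{JJ}` is
singular. -/
def IsSingularClass (X : Matrix (Fin n) (Fin n) ℝ) (J : Finset (Fin n)) : Prop :=
  IsClass X J ∧ (X.submatrix (fun j : J => (j : Fin n)) (fun j : J => (j : Fin n))).det = 0

/-- `J⁺ = {l | l > max J}` (used for nonempty `J`). -/
def after (J : Finset (Fin n)) : Set (Fin n) := {l | ∀ j ∈ J, j < l}

/-- The set `F` of a (singular) class `S` of `A`: all `l ≥ max S` such that some `j ≥ l` is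
accessed from `S` in the directed graph of `A`. -/
def setF (A : Matrix (Fin n) (Fin n) ℝ) (S : Finset (Fin n)) : Set (Fin n) :=
  {l | (∀ s ∈ S, s ≤ l) ∧ ∃ j, l ≤ j ∧ ∃ s ∈ S, Access A s j}

/-- The set `T` of a (singular) class `S` of `A`: all `l ≥ max S` such that some `j ≥ l` has
access to `S` in the directed graph of `A`. -/
def setT (A : Matrix (Fin n) (Fin n) ℝ) (S : Finset (Fin n)) : Set (Fin n) :=
  {l | (∀ s ∈ S, s ≤ l) ∧ ∃ j, l ≤ j ∧ ∃ s ∈ S, Access A j s}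

/-- A partition of the index set is order preserving if its blocks can be listed
so that smaller indices never lie in later blocks, i.e. of any two
distinct blocks one lies entirely before the other. The sequence of blocks is then determined by
the set of blocks. Refinement is the order `≤` of `Finpartition`. -/
def IsOrderPreserving (P : Finpartition (univ : Finset (Fin n))) : Prop :=
  ∀ B ∈ P.parts, ∀ C ∈ P.parts, B ≠ C →
    (∀ b ∈ B, ∀ c ∈ C, b < c) ∨ (∀ b ∈ B, ∀ c ∈ C, c < b)

/-- `X` is block lower triangular with respect to `P`: `X_{B B⁺} = 0` for every block `B`. -/
def IsBlockLower (X : Matrix (Fin n) (Fin n) ℝ)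
    (P : Finpartition (univ : Finset (Fin n))) : Prop :=
  ∀ B ∈ P.parts, ∀ i ∈ B, ∀ j ∈ after B, X i j = 0

/-- `X` is block upper triangular with respect to `P`: `X_{B⁺ B} = 0` for every block `B`. -/
def IsBlockUpper (X : Matrix (Fin n) (Fin n) ℝ)
    (P : Finpartition (univ : Finset (Fin n))) : Prop :=
  ∀ B ∈ P.parts, ∀ i ∈ after B, ∀ j ∈ B, X i j = 0

open Classical in
/-- The block lower triangular self-partition of `X`: the greatest lower bound (with respect to
refinement) of the order preserving partitions for which `X` is block lower triangular. -/
noncomputable def lowerSelfPartition (X : Matrix (Fin n) (Fin n) ℝ) :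
    Finpartition (univ : Finset (Fin n)) :=
  (univ.filter fun P : Finpartition (univ : Finset (Fin n)) =>
    IsOrderPreserving P ∧ IsBlockLower X P).inf id

open Classical in
/-- The block upper triangular self-partition of `X`: the greatest lower bound (with respect to
refinement) of the order preserving partitions for which `X` is block upper triangular. -/
noncomputable def upperSelfPartition (X : Matrix (Fin n) (Fin n) ℝ) :
    Finpartition (univ : Finset (Fin n)) :=
  (univ.filter fun P : Finpartition (univ : Finset (Fin n)) =>
    IsOrderPreserving P ∧ IsBlockUpper X P).inf id

/-- The partition `P` encompasses the set `J`: `J` is contained in one block of `P`. -/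
def Encompasses (P : Finpartition (univ : Finset (Fin n))) (J : Set (Fin n)) : Prop :=
  ∃ B ∈ P.parts, J ⊆ (B : Set (Fin n))

theorem isOrderPreserving_top : IsOrderPreserving (⊤ : Finpartition (univ : Finset (Fin n))) := by
  intro B hB C hC hne
  have h1 := Finpartition.parts_top_subset (univ : Finset (Fin n)) hB
  have h2 := Finpartition.parts_top_subset (univ : Finset (Fin n)) hC
  rw [mem_singleton] at h1 h2
  exact absurd (h1.trans h2.symm) hne

theorem isBlockLower_top (X : Matrix (Fin n) (Fin n) ℝ) :
    IsBlockLower X (⊤ : Finpartition (univ : Finset (Fin n))) := by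
  intro B hB i _ j hj
  have h1 := Finpartition.parts_top_subset (univ : Finset (Fin n)) hB
  rw [mem_singleton] at h1
  subst h1
  exact absurd (hj j (mem_univ j)) (lt_irrefl j)

theorem exists_of_mem_inf {P Q : Finpartition (univ : Finset (Fin n))} {B : Finset (Fin n)}
    (hB : B ∈ (P ⊓ Q).parts) : ∃ C ∈ P.parts, ∃ D ∈ Q.parts, B = C ∩ D := by
  rw [Finpartition.parts_inf] at hB
  obtain ⟨⟨C, D⟩, hCD, rfl⟩ := mem_image.mp (mem_of_mem_erase hB)
  obtain ⟨hC, hD⟩ := mem_product.mp hCD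
  exact ⟨C, hC, D, hD, rfl⟩

theorem IsOrderPreserving.inf {P Q : Finpartition (univ : Finset (Fin n))}
    (hP : IsOrderPreserving P) (hQ : IsOrderPreserving Q) : IsOrderPreserving (P ⊓ Q) := by
  intro B hB B' hB' hne
  obtain ⟨C, hC, D, hD, rfl⟩ := exists_of_mem_inf hB
  obtain ⟨C', hC', D', hD', rfl⟩ := exists_of_mem_inf hB'
  by_cases h : C = C'
  · have h' : D ≠ D' := by
      rintro rfl
      exact hne (by rw [h])
    refine (hQ D hD D' hD' h').imp ?_ ?_ <;>
      exact fun H b hb c hc => H b (mem_inter.mp hb).2 c (mem_inter.mp hc).2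
  · refine (hP C hC C' hC' h).imp ?_ ?_ <;>
      exact fun H b hb c hc => H b (mem_inter.mp hb).1 c (mem_inter.mp hc).1

theorem mem_after_of_not_mem {P : Finpartition (univ : Finset (Fin n))}
    (hP : IsOrderPreserving P) {B : Finset (Fin n)} (hB : B ∈ P.parts) {i j : Fin n}
    (hi : i ∈ B) (hj : j ∉ B) (hij : i < j) : j ∈ after B := by
  obtain ⟨C, hC, hjC⟩ := P.exists_mem (mem_univ j)
  have hne : B ≠ C := by
    rintro rfl
    exact hj hjC
  rcases hP B hB C hC hne with h | h
  · exact fun b hb => h b hb j hjC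
  · exact absurd (h i hi j hjC) (lt_asymm hij)

theorem IsBlockLower.inf {X : Matrix (Fin n) (Fin n) ℝ}
    {P Q : Finpartition (univ : Finset (Fin n))}
    (hP : IsOrderPreserving P) (hQ : IsOrderPreserving Q)
    (hXP : IsBlockLower X P) (hXQ : IsBlockLower X Q) : IsBlockLower X (P ⊓ Q) := by
  intro B hB i hi j hj
  obtain ⟨C, hC, D, hD, rfl⟩ := exists_of_mem_inf hB
  have hij : i < j := hj i hi
  obtain ⟨hiC, hiD⟩ := mem_inter.mp hi
  by_cases hjC : j ∈ C
  · by_cases hjD : j ∈ D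
    · exact absurd (hj j (mem_inter.mpr ⟨hjC, hjD⟩)) (lt_irrefl j)
    · exact hXQ D hD i hiD j (mem_after_of_not_mem hQ hD hiD hjD hij)
  · exact hXP C hC i hiC j (mem_after_of_not_mem hP hC hiC hjC hij)

theorem isBlockUpper_iff_transpose (X : Matrix (Fin n) (Fin n) ℝ)
    (P : Finpartition (univ : Finset (Fin n))) :
    IsBlockUpper X P ↔ IsBlockLower X.transpose P :=
  ⟨fun h B hB i hi j hj => h B hB j hj i hi, fun h B hB i hi j hj => h B hB j hj i hi⟩

/-- The lower self-partition is itself order preserving, `X` is block lower triangular with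
respect to it, and it refines every other such partition. -/
theorem isLeast_lowerSelfPartition (X : Matrix (Fin n) (Fin n) ℝ) :
    IsLeast {P | IsOrderPreserving P ∧ IsBlockLower X P} (lowerSelfPartition X) := by
  classical
  refine ⟨?_, fun P hP => Finset.inf_le (f := id) (by simpa using hP)⟩
  refine Finset.inf_induction
    (p := fun P => IsOrderPreserving P ∧ IsBlockLower X P) ?_ ?_ ?_
  · exact ⟨isOrderPreserving_top, isBlockLower_top X⟩
  · exact fun P hP Q hQ => ⟨hP.1.inf hQ.1, IsBlockLower.inf hP.1 hQ.1 hP.2 hQ.2⟩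
  · intro P hP
    simpa using hP

theorem upperSelfPartition_eq_transpose (X : Matrix (Fin n) (Fin n) ℝ) :
    upperSelfPartition X = lowerSelfPartition X.transpose := by
  unfold upperSelfPartition lowerSelfPartition
  congr 1
  ext P
  simp only [mem_filter, isBlockUpper_iff_transpose]

/-- The upper self-partition is itself order preserving, `X` is block upper triangular with
respect to it, and it refines every other such partition. -/
theorem isLeast_upperSelfPartition (X : Matrix (Fin n) (Fin n) ℝ) :
    IsLeast {P | IsOrderPreserving P ∧ IsBlockUpper X P} (upperSelfPartition X) := by
  simp only [upperSelfPartition_eq_transpose, isBlockUpper_iff_transpose]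
  exact isLeast_lowerSelfPartition X.transpose

end BlockLU

/-!
The proof works with inverse positivity: a Z-matrix (nonpositive off-diagonal entries) has a
nonnegative inverse iff it maps some positive vector to a positive vector, and `X` is an M-matrix
iff `X + ε I` is such a matrix for every `ε > 0`.

*Existence of `Q`* (`exists_isSingularClass_subset`). Suppose that no class inside `S` is singular
for `L` or for `U`, and let `D` be the diagonal matrix with entries `1` off `S` and `0` on `S`. By
Perron–Frobenius rigidity (`IsGeneralMMatrix.rigidity`) an irreducible M-matrix becomes nonsingular
when a nonzero nonnegative diagonal is added, so every class of `L + D` and of `U + D` is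
nonsingular and both are inverse positive. Their product `A + L D + D U + D D` is then an inverse
positive Z-matrix, hence so is its principal submatrix on `S`. That submatrix is `A_{SS}`, which is
singular: a contradiction.

*Containment of `F`* (`IsSingularClass.access_of_access_mul`). Let `q` lie in a singular class of
`L`. Then whatever is accessed from `q` in `A` is accessed from `q` in `L`. Take a positive left
null vector `v` of the singular block, extended by zero, and `r = v (L + ε I)⁻¹ ≥ 0`. As `ε` tends
to `0`, the entry of `r` at `q` is at least `v_q / ε`, while `r` vanishes off the vertices accessed
from `q` in `L`. But `r (A + ε U) = v U` is bounded, and reading off column `k` shows that if `r_k`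
is bounded and `A_{ik} ≠ 0` then `r_i` is bounded. So an `A`-path from `q` cannot end where `r`
vanishes. An `L`-path from `q ≤ max S` to `j` cannot cross a boundary of the lower
self-partition upwards, so the block of `max S` contains all `l` with `max S ≤ l ≤ j`.

*Containment of `T`* is the same statement for `Aᵀ = Uᵀ Lᵀ`.
-/

namespace BlockLU

/-! ### Z-matrices and inverse positivity -/

/-- `X` is a Z-matrix: its off-diagonal entries are nonpositive. -/
def IsZMatrix {ι : Type*} (X : Matrix ι ι ℝ) : Prop :=
  ∀ i j, i ≠ j → X i j ≤ 0

/-- `B` is invertible and its inverse is entrywise nonnegative. For a Z-matrix this says that it is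
a nonsingular M-matrix. -/
def IsInversePositive {ι : Type*} [Fintype ι] [DecidableEq ι] (B : Matrix ι ι ℝ) : Prop :=
  ∃ Y : Matrix ι ι ℝ, (∀ i j, 0 ≤ Y i j) ∧ B * Y = 1 ∧ Y * B = 1

/-- `X` is a possibly singular M-matrix, in a form that makes sense over every finite index type
and needs no spectral theory: a Z-matrix such that `X + ε I` is inverse positive for all `ε > 0`. -/
structure IsGeneralMMatrix {ι : Type*} [Fintype ι] [DecidableEq ι] (X : Matrix ι ι ℝ) : Prop where
  isZMatrix : IsZMatrix X
  shift : ∀ ε : ℝ, 0 < ε → IsInversePositive (X + ε • (1 : Matrix ι ι ℝ))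

theorem IsZMatrix.transpose {ι : Type*} {X : Matrix ι ι ℝ} (hX : IsZMatrix X) :
    IsZMatrix X.transpose :=
  fun i j h => hX j i h.symm

theorem IsZMatrix.add_diagonal {ι : Type*} [DecidableEq ι] {X : Matrix ι ι ℝ} (hX : IsZMatrix X)
    (d : ι → ℝ) : IsZMatrix (X + Matrix.diagonal d) := by
  intro i j h
  simpa [Matrix.diagonal_apply_ne _ h] using hX i j h

theorem IsZMatrix.add_smul_one {ι : Type*} [DecidableEq ι] {X : Matrix ι ι ℝ} (hX : IsZMatrix X)
    (ε : ℝ) : IsZMatrix (X + ε • (1 : Matrix ι ι ℝ)) := by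
  intro i j h
  simpa [Matrix.one_apply_ne h] using hX i j h

theorem mulVec_nonneg {ι : Type*} [Fintype ι] {Y : Matrix ι ι ℝ} (hY : ∀ i j, 0 ≤ Y i j)
    {x : ι → ℝ} (hx : ∀ i, 0 ≤ x i) (i : ι) : 0 ≤ Y.mulVec x i :=
  Finset.sum_nonneg fun j _ => mul_nonneg (hY i j) (hx j)

section

variable {ι : Type*} [Fintype ι] [DecidableEq ι]

theorem mulVec_eq_diag_add (B : Matrix ι ι ℝ) (x : ι → ℝ) (i : ι) :
    B.mulVec x i = B i i * x i + ∑ j ∈ Finset.univ.erase i, B i j * x j := by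
  exact (Finset.add_sum_erase Finset.univ (fun j => B i j * x j) (Finset.mem_univ i)).symm

theorem IsZMatrix.sum_erase_nonpos {B : Matrix ι ι ℝ} (hB : IsZMatrix B) {x : ι → ℝ}
    (hx : ∀ i, 0 ≤ x i) (i : ι) : ∑ j ∈ Finset.univ.erase i, B i j * x j ≤ 0 :=
  Finset.sum_nonpos fun j hj =>
    mul_nonpos_of_nonpos_of_nonneg (hB i j (Finset.ne_of_mem_erase hj).symm) (hx j)

theorem IsZMatrix.pos_of_mulVec_pos {B : Matrix ι ι ℝ} (hB : IsZMatrix B) {x : ι → ℝ}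
    (hx : ∀ i, 0 ≤ x i) {i : ι} (hi : 0 < B.mulVec x i) : 0 < B i i ∧ 0 < x i := by
  have h := mulVec_eq_diag_add B x i
  have h' := hB.sum_erase_nonpos hx i
  have h2 : 0 < B i i * x i := by linarith
  have hxi : 0 < x i := lt_of_le_of_ne (hx i) fun h0 => by rw [← h0] at h2; simp at h2
  exact ⟨pos_of_mul_pos_left h2 hxi.le, hxi⟩

/-- The set where a nonnegative `x` with `B x ≥ 0` vanishes is closed under the edges of `B`. -/
theorem IsZMatrix.eq_zero_of_edge {B : Matrix ι ι ℝ} (hB : IsZMatrix B) {x : ι → ℝ}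
    (hx : ∀ i, 0 ≤ x i) {i j : ι} (hi : 0 ≤ B.mulVec x i) (hxi : x i = 0) (hij : B i j ≠ 0) :
    x j = 0 := by
  by_cases h : i = j
  · rwa [← h]
  rw [mulVec_eq_diag_add, hxi, mul_zero, zero_add] at hi
  have hj : j ∈ Finset.univ.erase i := Finset.mem_erase.mpr ⟨Ne.symm h, Finset.mem_univ j⟩
  have h0 := (Finset.sum_eq_zero_iff_of_nonpos fun k hk =>
    mul_nonpos_of_nonpos_of_nonneg (hB i k (Finset.ne_of_mem_erase hk).symm) (hx k)).mp
      (le_antisymm (hB.sum_erase_nonpos hx i) hi) j hj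
  exact (mul_eq_zero.mp h0).resolve_left hij

theorem IsInversePositive.nonneg_of_mulVec_nonneg {B : Matrix ι ι ℝ} (hB : IsInversePositive B)
    {x : ι → ℝ} (hx : ∀ i, 0 ≤ B.mulVec x i) (i : ι) : 0 ≤ x i := by
  obtain ⟨Y, hY, -, hYB⟩ := hB
  have h : Y.mulVec (B.mulVec x) = x := by rw [Matrix.mulVec_mulVec, hYB, Matrix.one_mulVec]
  rw [← h]
  exact mulVec_nonneg hY hx i

theorem IsInversePositive.transpose {B : Matrix ι ι ℝ} (hB : IsInversePositive B) :
    IsInversePositive B.transpose := by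
  obtain ⟨Y, hY, h1, h2⟩ := hB
  refine ⟨Y.transpose, fun i j => hY j i, ?_, ?_⟩
  · rw [← Matrix.transpose_mul, h2, Matrix.transpose_one]
  · rw [← Matrix.transpose_mul, h1, Matrix.transpose_one]

theorem IsInversePositive.nonneg_of_vecMul_nonneg {B : Matrix ι ι ℝ} (hB : IsInversePositive B)
    {x : ι → ℝ} (hx : ∀ i, 0 ≤ Matrix.vecMul x B i) (i : ι) : 0 ≤ x i :=
  hB.transpose.nonneg_of_mulVec_nonneg (by simpa only [Matrix.mulVec_transpose] using hx) i

theorem IsInversePositive.mul {B C : Matrix ι ι ℝ} (hB : IsInversePositive B)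
    (hC : IsInversePositive C) : IsInversePositive (B * C) := by
  obtain ⟨Y, hY, h1, h2⟩ := hB
  obtain ⟨Z, hZ, h3, h4⟩ := hC
  refine ⟨Z * Y, fun i j => Finset.sum_nonneg fun k _ => mul_nonneg (hZ i k) (hY k j), ?_, ?_⟩
  · rw [Matrix.mul_assoc, ← Matrix.mul_assoc C, h3, Matrix.one_mul, h1]
  · rw [Matrix.mul_assoc, ← Matrix.mul_assoc Y, h2, Matrix.one_mul, h4]

theorem IsInversePositive.det_ne_zero {B : Matrix ι ι ℝ} (hB : IsInversePositive B) :
    B.det ≠ 0 := by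
  obtain ⟨Y, -, h, -⟩ := hB
  intro h0
  have := congrArg Matrix.det h
  rw [Matrix.det_mul, h0, zero_mul, Matrix.det_one] at this
  exact zero_ne_one this

/-- An inverse positive Z-matrix is semipositive: it maps some positive vector to a positive one. -/
theorem IsInversePositive.exists_pos {B : Matrix ι ι ℝ} (hB : IsInversePositive B)
    (hZ : IsZMatrix B) : ∃ u : ι → ℝ, (∀ i, 0 < u i) ∧ ∀ i, 0 < B.mulVec u i := by
  obtain ⟨Y, hY, h1, -⟩ := hB
  have h : B.mulVec (Y.mulVec 1) = 1 := by rw [Matrix.mulVec_mulVec, h1, Matrix.one_mulVec]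
  have hpos : ∀ i, 0 < B.mulVec (Y.mulVec 1) i := fun i => by rw [h]; exact one_pos
  refine ⟨Y.mulVec 1, fun i => (hZ.pos_of_mulVec_pos (fun j => ?_) (hpos i)).2, hpos⟩
  exact mulVec_nonneg hY (fun _ => zero_le_one) j

/-- The converse: a semipositive Z-matrix is inverse positive. If `B x ≥ 0` and `t` is the least
ratio `x i / u i`, then `t < 0` would make `x - t u` vanish at a minimising index and be
nonnegative elsewhere, while `B` maps it to a positive vector. -/
theorem IsZMatrix.isInversePositive {B : Matrix ι ι ℝ} (hB : IsZMatrix B) {u : ι → ℝ}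
    (hu : ∀ i, 0 < u i) (hBu : ∀ i, 0 < B.mulVec u i) : IsInversePositive B := by
  have mono : ∀ x : ι → ℝ, (∀ i, 0 ≤ B.mulVec x i) → ∀ i, 0 ≤ x i := by
    intro x hx i₀
    obtain ⟨i, -, hi⟩ := Finset.exists_min_image Finset.univ (fun i => x i / u i)
      ⟨i₀, Finset.mem_univ i₀⟩
    by_contra! hneg
    have ht : x i / u i < 0 :=
      (hi i₀ (Finset.mem_univ _)).trans_lt (div_neg_of_neg_of_pos hneg (hu i₀))
    set t := x i / u i with htdef
    have hw : ∀ j, 0 ≤ (x - t • u) j := by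
      intro j
      have := (le_div_iff₀ (hu j)).mp (hi j (Finset.mem_univ j))
      simpa using this
    have hBw : 0 < B.mulVec (x - t • u) i := by
      rw [Matrix.mulVec_sub, Matrix.mulVec_smul, Pi.sub_apply, Pi.smul_apply, smul_eq_mul]
      nlinarith [hx i, hBu i]
    have hpos := (hB.pos_of_mulVec_pos hw hBw).2
    have h0 : (x - t • u) i = 0 := by
      simp [htdef, div_mul_cancel₀ _ (hu i).ne']
    exact hpos.ne' h0
  have hdet : B.det ≠ 0 := by
    intro h0
    obtain ⟨x, hx, hBx⟩ := Matrix.exists_mulVec_eq_zero_iff.mpr h0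
    refine hx (funext fun i => le_antisymm ?_ (mono x (fun j => by rw [hBx]; rfl) i))
    have := mono (-x) (fun j => by rw [Matrix.mulVec_neg, hBx]; simp) i
    simpa using this
  have hunit : IsUnit B.det := isUnit_iff_ne_zero.mpr hdet
  refine ⟨B⁻¹, fun i j => ?_, Matrix.mul_nonsing_inv B hunit, Matrix.nonsing_inv_mul B hunit⟩
  refine mono (fun k => B⁻¹ k j) (fun k => ?_) i
  have : B.mulVec (fun k => B⁻¹ k j) k = (B * B⁻¹) k j := rfl
  rw [this, Matrix.mul_nonsing_inv B hunit, Matrix.one_apply]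
  split_ifs <;> norm_num

theorem IsInversePositive.submatrix {B : Matrix ι ι ℝ} (hB : IsInversePositive B)
    (hZ : IsZMatrix B) (J : Finset ι) :
    IsInversePositive (B.submatrix (fun j : J => (j : ι)) (fun j : J => (j : ι))) := by
  obtain ⟨u, hu, hBu⟩ := hB.exists_pos hZ
  refine IsZMatrix.isInversePositive (fun i j h => hZ i j fun h' => h (Subtype.ext h'))
    (u := fun j => u j) (fun j => hu j) fun i => (hBu i).trans_le ?_
  change ∑ j, B i j * u j ≤ ∑ j : J, B i j * u j
  rw [Finset.sum_coe_sort J (fun j => B i j * u j), ← Finset.sum_add_sum_compl J]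
  refine add_le_of_nonpos_right (Finset.sum_nonpos fun j hj => ?_)
  refine mul_nonpos_of_nonpos_of_nonneg (hZ i j ?_) (hu j).le
  rintro h
  exact Finset.mem_compl.mp hj (h ▸ i.2)

/-! ### M-matrices over a finite index type -/

theorem IsGeneralMMatrix.transpose {X : Matrix ι ι ℝ} (hX : IsGeneralMMatrix X) :
    IsGeneralMMatrix X.transpose := by
  refine ⟨hX.isZMatrix.transpose, fun ε hε => ?_⟩
  simpa using (hX.shift ε hε).transpose

theorem IsGeneralMMatrix.diag_nonneg {X : Matrix ι ι ℝ} (hX : IsGeneralMMatrix X) (i : ι) :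
    0 ≤ X i i := by
  refine le_of_forall_pos_le_add fun ε hε => ?_
  obtain ⟨u, hu, h⟩ := (hX.shift ε hε).exists_pos (hX.isZMatrix.add_smul_one ε)
  have := ((hX.isZMatrix.add_smul_one ε).pos_of_mulVec_pos (fun j => (hu j).le) (h i)).1
  simpa using this.le

theorem IsGeneralMMatrix.submatrix {X : Matrix ι ι ℝ} (hX : IsGeneralMMatrix X) (J : Finset ι) :
    IsGeneralMMatrix (X.submatrix (fun j : J => (j : ι)) (fun j : J => (j : ι))) := by
  refine ⟨fun i j h => hX.isZMatrix i j fun h' => h (Subtype.ext h'), fun ε hε => ?_⟩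
  have h := (hX.shift ε hε).submatrix (hX.isZMatrix.add_smul_one ε) J
  rwa [Matrix.submatrix_add, Pi.add_apply, Pi.add_apply, Matrix.submatrix_smul, Pi.smul_apply,
    Pi.smul_apply, Matrix.submatrix_one _ Subtype.val_injective] at h

theorem IsGeneralMMatrix.add_diagonal {X : Matrix ι ι ℝ} (hX : IsGeneralMMatrix X) {d : ι → ℝ}
    (hd : ∀ i, 0 ≤ d i) : IsGeneralMMatrix (X + Matrix.diagonal d) := by
  refine ⟨hX.isZMatrix.add_diagonal d, fun ε hε => ?_⟩
  obtain ⟨u, hu, h⟩ := (hX.shift ε hε).exists_pos (hX.isZMatrix.add_smul_one ε)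
  refine ((hX.isZMatrix.add_diagonal d).add_smul_one ε).isInversePositive hu fun i => ?_
  have h1 : (X + Matrix.diagonal d + ε • (1 : Matrix ι ι ℝ)).mulVec u i
      = (X + ε • (1 : Matrix ι ι ℝ)).mulVec u i + d i * u i := by
    simp only [Matrix.add_mulVec, Pi.add_apply, Matrix.mulVec_diagonal]
    ring
  rw [h1]
  exact add_pos_of_pos_of_nonneg (h i) (mul_nonneg (hd i) (hu i).le)

/-- A nonsingular M-matrix is inverse positive: `det (X + ε I) • adjugate (X + ε I)` is nonnegative
for `ε > 0`, and one lets `ε` tend to `0`. -/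
theorem IsGeneralMMatrix.isInversePositive {X : Matrix ι ι ℝ} (hX : IsGeneralMMatrix X)
    (hdet : X.det ≠ 0) : IsInversePositive X := by
  have hunit : IsUnit X.det := isUnit_iff_ne_zero.mpr hdet
  refine ⟨X⁻¹, fun i j => ?_, Matrix.mul_nonsing_inv X hunit, Matrix.nonsing_inv_mul X hunit⟩
  let f : ℝ → ℝ := fun ε => (X + ε • (1 : Matrix ι ι ℝ)).det *
    (X + ε • (1 : Matrix ι ι ℝ)).adjugate i j
  have hf : Continuous f := by
    have hc : Continuous fun ε : ℝ => X + ε • (1 : Matrix ι ι ℝ) := by fun_prop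
    exact hc.matrix_det.mul (hc.matrix_adjugate.matrix_elem i j)
  have hpos : ∀ ε : ℝ, 0 < ε → 0 ≤ f ε := by
    intro ε hε
    obtain ⟨Y, hY, h1, -⟩ := hX.shift ε hε
    have h2 : (X + ε • (1 : Matrix ι ι ℝ)).adjugate =
        (X + ε • (1 : Matrix ι ι ℝ)).det • Y := by
      have h3 := congrArg (fun Z => Z * Y) (Matrix.adjugate_mul (X + ε • (1 : Matrix ι ι ℝ)))
      simpa only [Matrix.mul_assoc, h1, Matrix.mul_one, Matrix.smul_mul, Matrix.one_mul] using h3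
    simp only [f, h2, Matrix.smul_apply, smul_eq_mul, ← mul_assoc]
    exact mul_nonneg (mul_self_nonneg _) (hY i j)
  have h0 : 0 ≤ f 0 :=
    ge_of_tendsto ((hf.tendsto 0).mono_left nhdsWithin_le_nhds)
      (Filter.eventually_of_mem self_mem_nhdsWithin hpos :
        ∀ᶠ ε in nhdsWithin 0 (Set.Ioi 0), 0 ≤ f ε)
  simp only [f, zero_smul, add_zero] at h0
  rw [Matrix.inv_def, Ring.inverse_eq_inv', Matrix.smul_apply, smul_eq_mul]
  have : X.det⁻¹ * X.adjugate i j = (X.det⁻¹) ^ 2 * (X.det * X.adjugate i j) := by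
    field_simp
  rw [this]
  exact mul_nonneg (sq_nonneg _) h0

/-! ### Irreducible M-matrices -/

/-- The directed graph of `X` is strongly connected. -/
def IsStronglyConnected {ι : Type*} (X : Matrix ι ι ℝ) : Prop :=
  ∀ i j, Relation.ReflTransGen (fun i j => X i j ≠ 0) i j

theorem IsStronglyConnected.transpose {ι : Type*} {X : Matrix ι ι ℝ}
    (hX : IsStronglyConnected X) : IsStronglyConnected X.transpose :=
  fun i j => Relation.reflTransGen_swap.mp (hX j i)

theorem IsZMatrix.pos_of_isStronglyConnected {X : Matrix ι ι ℝ} (hX : IsZMatrix X)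
    (hirr : IsStronglyConnected X) {y : ι → ℝ} (hy : ∀ i, 0 ≤ y i) (hne : y ≠ 0)
    (hXy : ∀ i, 0 ≤ X.mulVec y i) (i : ι) : 0 < y i := by
  refine lt_of_le_of_ne (hy i) fun h0 => hne (funext fun j => ?_)
  induction hirr i j with
  | refl => exact h0.symm
  | tail _ he ih => exact hX.eq_zero_of_edge hy (hXy _) ih he

/-- An irreducible M-matrix maps some positive vector to a nonnegative one: a limit point of the
normalised vectors `(X + ε I)⁻¹ 1` as `ε` tends to `0`. -/
theorem IsGeneralMMatrix.exists_pos_mulVec_nonneg [Nonempty ι] {X : Matrix ι ι ℝ}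
    (hX : IsGeneralMMatrix X) (hirr : IsStronglyConnected X) :
    ∃ y : ι → ℝ, (∀ i, 0 < y i) ∧ ∀ i, 0 ≤ X.mulVec y i := by
  have key : ∀ k : ℕ, ∃ y ∈ stdSimplex ℝ ι, ∀ i, 0 ≤ X.mulVec y i + (1 / ((k : ℝ) + 1)) * y i := by
    intro k
    have hε : (0 : ℝ) < 1 / ((k : ℝ) + 1) := by positivity
    obtain ⟨u, hu, h⟩ := (hX.shift _ hε).exists_pos (hX.isZMatrix.add_smul_one _)
    have hs : 0 < ∑ i, u i := Finset.sum_pos (fun i _ => hu i) Finset.univ_nonempty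
    refine ⟨(∑ i, u i)⁻¹ • u, ⟨fun i => ?_, ?_⟩, fun i => ?_⟩
    · exact mul_nonneg (inv_nonneg.mpr hs.le) (hu i).le
    · simp only [Pi.smul_apply, smul_eq_mul, ← Finset.mul_sum]
      exact inv_mul_cancel₀ hs.ne'
    · have h1 := h i
      rw [Matrix.add_mulVec, Matrix.smul_mulVec, Matrix.one_mulVec] at h1
      rw [Matrix.mulVec_smul]
      have h2 := mul_nonneg (inv_nonneg.mpr hs.le) h1.le
      simp only [Pi.add_apply, Pi.smul_apply, smul_eq_mul] at h2 ⊢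
      linarith
  choose y hy hXy using key
  obtain ⟨a, ha, φ, hφ, hlim⟩ := (isCompact_stdSimplex ℝ ι).tendsto_subseq hy
  have hne : a ≠ 0 := by
    rintro rfl
    simpa using ha.2
  have hXa : ∀ i, 0 ≤ X.mulVec a i := by
    intro i
    have hε : Filter.Tendsto (fun k : ℕ => 1 / ((φ k : ℝ) + 1)) Filter.atTop (nhds 0) :=
      (tendsto_one_div_add_atTop_nhds_zero_nat (𝕜 := ℝ)).comp hφ.tendsto_atTop
    have hc : Continuous fun x : ι → ℝ => X.mulVec x i := by
      simp only [Matrix.mulVec, dotProduct]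
      fun_prop
    have h1 := ((hc.tendsto a).comp hlim).add
      (hε.mul (((continuous_apply i).tendsto a).comp hlim))
    rw [zero_mul, add_zero] at h1
    exact ge_of_tendsto' h1 fun k => hXy (φ k) i
  exact ⟨a, hX.isZMatrix.pos_of_isStronglyConnected hirr ha.1 hne hXa, hXa⟩

/-- Taking absolute values in a null vector of a Z-matrix with nonnegative diagonal. -/
theorem IsZMatrix.mulVec_abs_nonpos {X : Matrix ι ι ℝ} (hX : IsZMatrix X)
    (hdiag : ∀ i, 0 ≤ X i i) {x : ι → ℝ} (hx : X.mulVec x = 0) (i : ι) :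
    X.mulVec (fun j => |x j|) i ≤ 0 := by
  have h := congrFun hx i
  rw [mulVec_eq_diag_add, Pi.zero_apply] at h
  rw [mulVec_eq_diag_add]
  have h1 : X i i * |x i| = |∑ j ∈ Finset.univ.erase i, X i j * x j| := by
    rw [← abs_neg (Finset.sum _ _), ← eq_neg_of_add_eq_zero_left h, abs_mul,
      abs_of_nonneg (hdiag i)]
  have h2 : |∑ j ∈ Finset.univ.erase i, X i j * x j|
      ≤ -∑ j ∈ Finset.univ.erase i, X i j * |x j| := by
    rw [← Finset.sum_neg_distrib]
    refine (Finset.abs_sum_le_sum_abs _ _).trans (Finset.sum_le_sum fun j hj => ?_)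
    rw [abs_mul, abs_of_nonpos (hX i j (Finset.ne_of_mem_erase hj).symm), neg_mul]
  linarith

/-- Perron–Frobenius rigidity. Pair `(X + diag d) z ≤ 0` with a positive `y` such that `y X ≥ 0`:
all the inequalities become equalities. -/
theorem IsGeneralMMatrix.rigidity {X : Matrix ι ι ℝ} (hX : IsGeneralMMatrix X)
    (hirr : IsStronglyConnected X) {d z : ι → ℝ} (hd : ∀ i, 0 ≤ d i) (hz : ∀ i, 0 ≤ z i)
    (hne : z ≠ 0) (h : ∀ i, (X + Matrix.diagonal d).mulVec z i ≤ 0) :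
    X.mulVec z = 0 ∧ (∀ i, d i = 0) ∧
      ∃ y : ι → ℝ, (∀ i, 0 < y i) ∧ Matrix.vecMul y X = 0 := by
  have : Nonempty ι := by
    by_contra hemp
    rw [not_nonempty_iff] at hemp
    exact hne (Subsingleton.elim _ _)
  obtain ⟨y, hy, hyX⟩ := hX.transpose.exists_pos_mulVec_nonneg hirr.transpose
  simp only [Matrix.mulVec_transpose] at hyX
  have hmul : ∀ i, (X + Matrix.diagonal d).mulVec z i = X.mulVec z i + d i * z i := by
    intro i
    simp only [Matrix.add_mulVec, Pi.add_apply, Matrix.mulVec_diagonal]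
  have hpair : ∑ i, y i * (X.mulVec z i + d i * z i)
      = ∑ i, Matrix.vecMul y X i * z i + ∑ i, y i * (d i * z i) := by
    simp only [mul_add, Finset.sum_add_distrib]
    congr 1
    exact Matrix.dotProduct_mulVec y X z
  have hn1 : ∀ i ∈ Finset.univ, y i * (X.mulVec z i + d i * z i) ≤ 0 := fun i _ =>
    mul_nonpos_of_nonneg_of_nonpos (hy i).le (hmul i ▸ h i)
  have hn2 : ∀ i ∈ Finset.univ, 0 ≤ Matrix.vecMul y X i * z i := fun i _ =>
    mul_nonneg (hyX i) (hz i)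
  have hn3 : ∀ i ∈ Finset.univ, 0 ≤ y i * (d i * z i) := fun i _ =>
    mul_nonneg (hy i).le (mul_nonneg (hd i) (hz i))
  have s1 := Finset.sum_nonpos hn1
  have s2 := Finset.sum_nonneg hn2
  have s3 := Finset.sum_nonneg hn3
  have e1 := (Finset.sum_eq_zero_iff_of_nonpos hn1).mp (by linarith)
  have e2 := (Finset.sum_eq_zero_iff_of_nonneg hn2).mp (by linarith)
  have e3 := (Finset.sum_eq_zero_iff_of_nonneg hn3).mp (by linarith)
  have hdz : ∀ i, d i * z i = 0 := fun i =>
    (mul_eq_zero.mp (e3 i (Finset.mem_univ i))).resolve_left (hy i).ne'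
  have hXz : X.mulVec z = 0 := funext fun i => by
    have := (mul_eq_zero.mp (e1 i (Finset.mem_univ i))).resolve_left (hy i).ne'
    rwa [hdz, add_zero] at this
  have hzpos := hX.isZMatrix.pos_of_isStronglyConnected hirr hz hne
    (fun i => (congrFun hXz i).ge)
  exact ⟨hXz, fun i => (mul_eq_zero.mp (hdz i)).resolve_right (hzpos i).ne', y, hy,
    funext fun i => (mul_eq_zero.mp (e2 i (Finset.mem_univ i))).resolve_right (hzpos i).ne'⟩

/-- A singular irreducible M-matrix has a positive left null vector. -/
theorem IsGeneralMMatrix.exists_pos_vecMul_eq_zero {X : Matrix ι ι ℝ} (hX : IsGeneralMMatrix X)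
    (hirr : IsStronglyConnected X) (hdet : X.det = 0) :
    ∃ y : ι → ℝ, (∀ i, 0 < y i) ∧ Matrix.vecMul y X = 0 := by
  obtain ⟨x, hx, hXx⟩ := Matrix.exists_mulVec_eq_zero_iff.mpr hdet
  refine (hX.rigidity hirr (d := 0) (z := fun j => |x j|) (fun _ => le_rfl)
    (fun j => abs_nonneg _) ?_ fun i => ?_).2.2
  · intro h
    exact hx (funext fun j => abs_eq_zero.mp (congrFun h j))
  · simpa using hX.isZMatrix.mulVec_abs_nonpos hX.diag_nonneg hXx i

end

/-! ### The spectral definition -/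

open scoped Matrix.Norms.Operator in
/-- If the spectral radius of `P ≥ 0` is below `s`, then Gelfand's formula makes all row sums of
some power `P ^ N` smaller than `s ^ N`, and `u = (∑ s ^ i P ^ (N - 1 - i)) 1` satisfies
`(s I - P) u = (s ^ N I - P ^ N) 1`. -/
theorem exists_pos_of_spectralRadius_lt {n : ℕ} {P : Matrix (Fin n) (Fin n) ℝ}
    (hP : ∀ i j, 0 ≤ P i j) {s : ℝ} (hs : 0 < s)
    (hrad : spectralRadius ℂ (P.map Complex.ofReal) < ENNReal.ofReal s) :
    ∃ u : Fin n → ℝ, (∀ i, 0 < u i) ∧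
      ∀ i, 0 < (s • (1 : Matrix (Fin n) (Fin n) ℝ) - P).mulVec u i := by
  have hpow : ∀ k i j, 0 ≤ (P ^ k) i j := by
    intro k
    induction k with
    | zero =>
      intro i j
      rw [pow_zero, Matrix.one_apply]
      split_ifs <;> norm_num
    | succ k ih =>
      intro i j
      rw [pow_succ, Matrix.mul_apply]
      exact Finset.sum_nonneg fun l _ => mul_nonneg (ih i l) (hP l j)
  obtain ⟨N, hN, hN1⟩ := (((spectrum.pow_nnnorm_pow_one_div_tendsto_nhds_spectralRadius
    (P.map Complex.ofReal)).eventually_lt_const hrad).and (Filter.eventually_ge_atTop 1)).exists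
  have hnorm : ‖(P.map Complex.ofReal) ^ N‖₊ < s.toNNReal ^ N := by
    have hN0 : N ≠ 0 := by omega
    have h1 := ENNReal.pow_lt_pow_left hN0 hN
    have h2 : ((‖(P.map Complex.ofReal) ^ N‖₊ : ENNReal) ^ (1 / N : ℝ)) ^ N
        = ‖(P.map Complex.ofReal) ^ N‖₊ := by
      rw [← ENNReal.rpow_natCast, ← ENNReal.rpow_mul,
        one_div_mul_cancel (Nat.cast_ne_zero.mpr hN0), ENNReal.rpow_one]
    rw [h2, ENNReal.ofReal] at h1
    exact_mod_cast h1
  have hrow : ∀ i, (P ^ N).mulVec 1 i < s ^ N := by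
    intro i
    have h1 : ∑ j, ‖((P.map Complex.ofReal) ^ N) i j‖₊ < s.toNNReal ^ N := by
      refine lt_of_le_of_lt ?_ hnorm
      rw [Matrix.linfty_opNNNorm_def]
      exact Finset.le_sup (f := fun i => ∑ j, ‖((P.map Complex.ofReal) ^ N) i j‖₊)
        (Finset.mem_univ i)
    have h2 : ∑ j, ‖((P.map Complex.ofReal) ^ N) i j‖ < s ^ N := by
      have h3 : ((∑ j, ‖((P.map Complex.ofReal) ^ N) i j‖₊ : NNReal) : ℝ)
          < ((s.toNNReal ^ N : NNReal) : ℝ) := by exact_mod_cast h1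
      rw [NNReal.coe_pow, Real.coe_toNNReal s hs.le] at h3
      simpa using h3
    have h4 : (P.map Complex.ofReal) ^ N = (P ^ N).map Complex.ofReal :=
      (Matrix.map_pow P Complex.ofRealHom N).symm
    refine lt_of_le_of_lt (le_of_eq ?_) h2
    rw [h4]
    simp only [Matrix.mulVec, dotProduct, Pi.one_apply, mul_one, Matrix.map_apply,
      Complex.norm_real]
    exact Finset.sum_congr rfl fun j _ => (abs_of_nonneg (hpow N i j)).symm
  set G : Matrix (Fin n) (Fin n) ℝ :=
    ∑ i ∈ Finset.range N, (s • (1 : Matrix (Fin n) (Fin n) ℝ)) ^ i * P ^ (N - 1 - i) with hG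
  have hcomm : Commute (s • (1 : Matrix (Fin n) (Fin n) ℝ)) P :=
    (Commute.one_left P).smul_left s
  have hgeom := hcomm.mul_geom_sum₂ N
  rw [← hG] at hgeom
  have hGnonneg : ∀ i j, 0 ≤ G i j := by
    intro i j
    rw [hG, Matrix.sum_apply]
    refine Finset.sum_nonneg fun k _ => ?_
    rw [smul_pow, one_pow, Matrix.smul_mul, Matrix.one_mul]
    exact mul_nonneg (pow_nonneg hs.le _) (hpow _ i j)
  have hpos : ∀ i, 0 < (s • (1 : Matrix (Fin n) (Fin n) ℝ) - P).mulVec (G.mulVec 1) i := by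
    intro i
    rw [Matrix.mulVec_mulVec, hgeom, Matrix.sub_mulVec, smul_pow, one_pow, Matrix.smul_mulVec,
      Matrix.one_mulVec]
    simpa using hrow i
  refine ⟨G.mulVec 1, fun i => ?_, hpos⟩
  refine (IsZMatrix.pos_of_mulVec_pos ?_ (fun j => ?_) (hpos i)).2
  · intro a b hab
    simpa [Matrix.one_apply_ne hab] using hP a b
  · exact mulVec_nonneg hGnonneg (fun _ => zero_le_one) j

theorem IsMMatrix.isGeneralMMatrix {n : ℕ} {X : Matrix (Fin n) (Fin n) ℝ} (hX : IsMMatrix X) :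
    IsGeneralMMatrix X := by
  obtain ⟨α, P, hP, rfl, hα, hrad⟩ := hX
  have hZ : IsZMatrix (α • (1 : Matrix (Fin n) (Fin n) ℝ) - P) := fun i j h => by
    simpa [Matrix.one_apply_ne h] using hP i j
  refine ⟨hZ, fun ε hε => ?_⟩
  obtain ⟨u, hu, h⟩ := exists_pos_of_spectralRadius_lt hP (s := α + ε) (by linarith)
    (hrad.trans_lt ((ENNReal.ofReal_lt_ofReal_iff (by linarith)).mpr (by linarith)))
  refine (hZ.add_smul_one ε).isInversePositive hu fun i => ?_
  have : α • (1 : Matrix (Fin n) (Fin n) ℝ) - P + ε • 1 = (α + ε) • 1 - P := by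
    rw [add_smul]
    abel
  rw [this]
  exact h i

/-! ### Classes -/

section

variable {n : ℕ} {X : Matrix (Fin n) (Fin n) ℝ}

theorem access_transpose {i j : Fin n} : Access X.transpose i j ↔ Access X j i :=
  Relation.reflTransGen_swap

theorem IsClass.access {J : Finset (Fin n)} (hJ : IsClass X J) {i j : Fin n} (hi : i ∈ J)
    (hj : j ∈ J) : Access X i j := by
  obtain ⟨k, hk⟩ := hJ
  exact ((hk i).mp hi).2.trans ((hk j).mp hj).1

theorem IsClass.mem {J : Finset (Fin n)} (hJ : IsClass X J) {i j : Fin n} (hi : i ∈ J)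
    (hij : Access X i j) (hji : Access X j i) : j ∈ J := by
  obtain ⟨k, hk⟩ := hJ
  exact (hk j).mpr ⟨((hk i).mp hi).1.trans hij, hji.trans ((hk i).mp hi).2⟩

theorem IsClass.nonempty {J : Finset (Fin n)} (hJ : IsClass X J) : J.Nonempty := by
  obtain ⟨k, hk⟩ := hJ
  exact ⟨k, (hk k).mpr ⟨.refl, .refl⟩⟩

theorem isSingularClass_transpose {J : Finset (Fin n)} :
    IsSingularClass X.transpose J ↔ IsSingularClass X J := by
  have hc : IsClass X.transpose J ↔ IsClass X J := by
    unfold IsClass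
    simp only [access_transpose, and_comm]
  rw [IsSingularClass, IsSingularClass, hc, ← Matrix.transpose_submatrix, Matrix.det_transpose]

/-- The principal submatrix on a class is irreducible: a path between two vertices of a class does
not leave the class. -/
theorem IsClass.isStronglyConnected {J : Finset (Fin n)} (hJ : IsClass X J) :
    IsStronglyConnected (X.submatrix (fun j : J => (j : Fin n)) (fun j : J => (j : Fin n))) := by
  rintro i ⟨j, hj⟩
  have hij : Access X i j := hJ.access i.2 hj
  induction hij with
  | refl => exact .refl
  | @tail k l hik hkl ih =>
    have hk : k ∈ J := hJ.mem i.2 hik (.head hkl (hJ.access hj i.2))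
    exact (ih hk).tail hkl

/-- If no class inside `S` is singular, then adding `1` to the diagonal entries outside `S` makes
an M-matrix nonsingular. -/
theorem IsGeneralMMatrix.isInversePositive_add_diagonal (hX : IsGeneralMMatrix X)
    {S : Finset (Fin n)} (hS : ∀ Q ⊆ S, ¬ IsSingularClass X Q) :
    IsInversePositive (X + Matrix.diagonal fun i => if i ∈ S then 0 else 1) := by
  classical
  set d : Fin n → ℝ := fun i => if i ∈ S then 0 else 1 with hd
  have hd0 : ∀ i, 0 ≤ d i := fun i => by
    simp only [hd]
    split_ifs <;> norm_num
  have hX' := hX.add_diagonal hd0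
  refine hX'.isInversePositive fun hdet => ?_
  obtain ⟨x, hx, hXx⟩ := Matrix.exists_mulVec_eq_zero_iff.mpr hdet
  have hz := hX'.isZMatrix.mulVec_abs_nonpos hX'.diag_nonneg hXx
  -- A vertex `i` of the support of `x` with the fewest accessible vertices: then `x` vanishes on
  -- all that is accessible from `i` outside its class.
  let reach : Fin n → Finset (Fin n) := fun i => Finset.univ.filter fun j => Access X i j
  obtain ⟨a, ha⟩ := Function.ne_iff.mp hx
  obtain ⟨i, hi, hmin⟩ := Finset.exists_min_image (Finset.univ.filter fun i => x i ≠ 0)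
    (fun i => (reach i).card) ⟨a, by simpa using ha⟩
  have hxi : x i ≠ 0 := (Finset.mem_filter.mp hi).2
  let J : Finset (Fin n) := Finset.univ.filter fun j => Access X i j ∧ Access X j i
  have hJ : IsClass X J := ⟨i, fun j => by simp [J]⟩
  have hiJ : i ∈ J := Finset.mem_filter.mpr ⟨Finset.mem_univ i, .refl, .refl⟩
  have hout : ∀ j, Access X i j → j ∉ J → x j = 0 := by
    intro j hij hj
    by_contra hxj
    have hsub : reach j ⊆ reach i := fun k hk => by
      simp only [reach, Finset.mem_filter, Finset.mem_univ, true_and] at hk ⊢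
      exact hij.trans hk
    have heq := Finset.eq_of_subset_of_card_le hsub
      (hmin j (Finset.mem_filter.mpr ⟨Finset.mem_univ j, hxj⟩))
    have hji : i ∈ reach j := by
      rw [heq]
      exact Finset.mem_filter.mpr ⟨Finset.mem_univ i, .refl⟩
    exact hj (hJ.mem hiJ hij (by simpa [reach] using hji))
  let XJ := X.submatrix (fun j : J => (j : Fin n)) (fun j : J => (j : Fin n))
  have hrow : ∀ k : J, (XJ + Matrix.diagonal fun j : J => d j).mulVec (fun j : J => |x j|) k
      = (X + Matrix.diagonal d).mulVec (fun j => |x j|) k := by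
    intro k
    rw [Matrix.add_mulVec, Matrix.add_mulVec, Pi.add_apply, Pi.add_apply, Matrix.mulVec_diagonal,
      Matrix.mulVec_diagonal]
    congr 1
    change ∑ j : J, X k j * |x j| = ∑ j, X k j * |x j|
    rw [Finset.sum_coe_sort J (fun j => X k j * |x j|)]
    refine Finset.sum_subset (Finset.subset_univ J) fun j _ hj => ?_
    by_cases hkj : X k j = 0
    · rw [hkj, zero_mul]
    · rw [hout j ((hJ.access hiJ k.2).tail hkj) hj, abs_zero, mul_zero]
  have hne : (fun j : J => |x j|) ≠ 0 := fun h => hxi (abs_eq_zero.mp (congrFun h ⟨i, hiJ⟩))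
  obtain ⟨hker, hdJ, -⟩ := (hX.submatrix J).rigidity hJ.isStronglyConnected
    (d := fun j : J => d j) (fun j => hd0 j) (fun j => abs_nonneg _) hne
    fun k => (hrow k).trans_le (hz k)
  refine hS J (fun j hj => ?_) ⟨hJ, Matrix.exists_mulVec_eq_zero_iff.mp ⟨_, hne, hker⟩⟩
  by_contra hjS
  have := hdJ ⟨j, hj⟩
  simp [hd, hjS] at this

end

/-! ### Singular classes of a product -/

section

variable {n : ℕ} {A L U : Matrix (Fin n) (Fin n) ℝ}

/-- Adding the diagonal matrix `D` supported off `S` to both factors changes `L U` to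
`L U + L D + D U + D D`, which is still a Z-matrix and has the same principal submatrix on `S`. -/
theorem exists_isSingularClass_subset (hA : IsZMatrix A) (hL : IsGeneralMMatrix L)
    (hU : IsGeneralMMatrix U) (hfac : A = L * U) {S : Finset (Fin n)}
    (hS : (A.submatrix (fun j : S => (j : Fin n)) (fun j : S => (j : Fin n))).det = 0) :
    ∃ Q ⊆ S, IsSingularClass L Q ∨ IsSingularClass U Q := by
  by_contra! hcon
  have hL' := hL.isInversePositive_add_diagonal fun Q hQ => (hcon Q hQ).1
  have hU' := hU.isInversePositive_add_diagonal fun Q hQ => (hcon Q hQ).2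
  set d : Fin n → ℝ := fun i => if i ∈ S then 0 else 1 with hd
  have hd0 : ∀ i, 0 ≤ d i := fun i => by
    simp only [hd]
    split_ifs <;> norm_num
  have hentry : ∀ i j, ((L + Matrix.diagonal d) * (U + Matrix.diagonal d)) i j
      = A i j + L i j * d j + d i * U i j + d i * Matrix.diagonal d i j := by
    intro i j
    rw [add_mul, mul_add, mul_add, ← hfac, Matrix.add_apply, Matrix.add_apply, Matrix.add_apply,
      Matrix.mul_diagonal, Matrix.diagonal_mul, Matrix.diagonal_mul]
    ring
  have hZ : IsZMatrix ((L + Matrix.diagonal d) * (U + Matrix.diagonal d)) := by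
    intro i j hij
    rw [hentry, Matrix.diagonal_apply_ne _ hij, mul_zero, add_zero]
    have h1 := mul_nonpos_of_nonpos_of_nonneg (hL.isZMatrix i j hij) (hd0 j)
    have h2 := mul_nonpos_of_nonneg_of_nonpos (hd0 i) (hU.isZMatrix i j hij)
    linarith [hA i j hij]
  refine ((hL'.mul hU').submatrix hZ S).det_ne_zero ?_
  rw [← hS]
  congr 1
  ext i j
  rw [Matrix.submatrix_apply, Matrix.submatrix_apply, hentry]
  simp [hd, i.2, j.2]

/-- If `v ≥ 0` is supported where `q` has access to, then so is `v (L + ε I)⁻¹`: truncating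
`r = v (L + ε I)⁻¹` to the vertices accessed from `q` gives a vector that is at least `r`. -/
theorem eq_zero_of_not_access (hL : IsGeneralMMatrix L) {q : Fin n} {v r : Fin n → ℝ} {ε : ℝ}
    (hε : 0 < ε) (hv : ∀ i, ¬ Access L q i → v i = 0) (hr : ∀ i, 0 ≤ r i)
    (hrv : Matrix.vecMul r (L + ε • (1 : Matrix (Fin n) (Fin n) ℝ)) = v)
    {j : Fin n} (hj : ¬ Access L q j) : r j = 0 := by
  classical
  set B := L + ε • (1 : Matrix (Fin n) (Fin n) ℝ) with hB
  have hBZ : IsZMatrix B := hL.isZMatrix.add_smul_one ε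
  let r' : Fin n → ℝ := fun i => if Access L q i then r i else 0
  have hge : ∀ k, 0 ≤ Matrix.vecMul (r' - r) B k := by
    intro k
    rw [Matrix.sub_vecMul, Pi.sub_apply, hrv]
    by_cases hk : Access L q k
    · rw [← hrv, sub_nonneg]
      change ∑ i, r i * B i k ≤ ∑ i, r' i * B i k
      refine Finset.sum_le_sum fun i _ => ?_
      by_cases hi : Access L q i
      · simp [r', hi]
      · simp only [r', hi, if_false, zero_mul]
        exact mul_nonpos_of_nonneg_of_nonpos (hr i) (hBZ i k fun h => hi (h ▸ hk))
    · rw [hv k hk, sub_zero]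
      change 0 ≤ ∑ i, r' i * B i k
      refine Finset.sum_nonneg fun i _ => ?_
      by_cases hi : Access L q i
      · have hik : i ≠ k := fun h => hk (h ▸ hi)
        have hLik : L i k = 0 := by
          by_contra h
          exact hk (hi.tail h)
        simp [hB, hLik, Matrix.one_apply_ne hik]
      · simp [r', hi]
  have := (hL.shift ε hε).nonneg_of_vecMul_nonneg hge j
  simp only [r', Pi.sub_apply, hj, if_false, zero_sub, Left.nonneg_neg_iff] at this
  exact le_antisymm this (hr j)

/-- From a vertex of a singular class of `L`, access in `L U` implies access in `L`. With a left
null vector `v > 0` of the singular block, `r ε = v (L + ε I)⁻¹` blows up at `q` and vanishes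
off the vertices that `q` has access to in `L`, while `r ε (A + ε U) = v U` lets boundedness
of `r ε` propagate backwards along the edges of `A`. -/
theorem IsSingularClass.access_of_access_mul (hA : IsZMatrix A) (hL : IsGeneralMMatrix L)
    (hU : IsZMatrix U) (hfac : A = L * U) {Q : Finset (Fin n)} (hQ : IsSingularClass L Q)
    {q j : Fin n} (hq : q ∈ Q) (hqj : Access A q j) : Access L q j := by
  classical
  by_contra hj
  obtain ⟨y, hy, hyL⟩ := (hL.submatrix Q).exists_pos_vecMul_eq_zero hQ.1.isStronglyConnected hQ.2
  let v : Fin n → ℝ := fun i => if h : i ∈ Q then y ⟨i, h⟩ else 0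
  have hv0 : ∀ i, 0 ≤ v i := fun i => by
    simp only [v]
    split_ifs with h
    exacts [(hy _).le, le_rfl]
  have hvQ : ∀ i, i ∉ Q → v i = 0 := fun i hi => by simp [v, hi]
  have hvL : ∀ k, Matrix.vecMul v L k ≤ 0 := by
    intro k
    by_cases hk : k ∈ Q
    · have h1 : Matrix.vecMul v L k = ∑ i : Q, y i * L i k := by
        change ∑ i, v i * L i k = _
        rw [← Finset.sum_subset (Finset.subset_univ Q)
          (fun i _ hi => by rw [hvQ i hi, zero_mul]), ← Finset.sum_coe_sort Q]
        exact Finset.sum_congr rfl fun i _ => by simp [v]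
      rw [h1]
      exact (congrFun hyL ⟨k, hk⟩).le
    · change ∑ i, v i * L i k ≤ 0
      refine Finset.sum_nonpos fun i _ => ?_
      by_cases hi : i ∈ Q
      · exact mul_nonpos_of_nonneg_of_nonpos (hv0 i)
          (hL.isZMatrix i k fun h => hk (h ▸ hi))
      · rw [hvQ i hi, zero_mul]
  have hex : ∀ ε : ℝ, ∃ r : Fin n → ℝ, 0 < ε → (∀ i, 0 ≤ r i) ∧
      Matrix.vecMul r (L + ε • (1 : Matrix (Fin n) (Fin n) ℝ)) = v := by
    intro ε
    by_cases hε : 0 < ε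
    · obtain ⟨Y, hY, -, h⟩ := hL.shift ε hε
      refine ⟨Matrix.vecMul v Y, fun _ => ⟨fun i => ?_, ?_⟩⟩
      · rw [← Matrix.mulVec_transpose]
        exact mulVec_nonneg (fun a b => hY b a) hv0 i
      · rw [Matrix.vecMul_vecMul, h, Matrix.vecMul_one]
    · exact ⟨0, fun h => absurd h hε⟩
  choose r hr using hex
  -- `r ε ≥ ε⁻¹ v`, because `(r ε - ε⁻¹ v) (L + ε I) = - ε⁻¹ v L ≥ 0`.
  have hlower : ∀ ε, 0 < ε → ∀ i, ε⁻¹ * v i ≤ r ε i := by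
    intro ε hε i
    have h := (hL.shift ε hε).nonneg_of_vecMul_nonneg (x := r ε - ε⁻¹ • v) (fun k => ?_) i
    · simpa using h
    · rw [Matrix.sub_vecMul, (hr ε hε).2, Matrix.smul_vecMul, Matrix.vecMul_add,
        Matrix.vecMul_smul, Matrix.vecMul_one]
      have h1 := mul_nonpos_of_nonneg_of_nonpos (inv_nonneg.mpr hε.le) (hvL k)
      have h2 : ε⁻¹ * (ε * v k) = v k := by field_simp
      simp only [Pi.sub_apply, Pi.smul_apply, Pi.add_apply, smul_eq_mul, mul_add, h2]
      linarith
  have hmul : ∀ ε, 0 < ε → Matrix.vecMul (r ε) (A + ε • U) = Matrix.vecMul v U := by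
    intro ε hε
    rw [← (hr ε hε).2, Matrix.vecMul_vecMul, add_mul, ← hfac, Matrix.smul_mul, Matrix.one_mul]
  have hback : ∀ i k, A i k ≠ 0 → (∃ C, ∀ ε, 0 < ε → ε ≤ 1 → r ε k ≤ C) →
      ∃ C, ∀ ε, 0 < ε → ε ≤ 1 → r ε i ≤ C := by
    rintro i k hik ⟨C, hC⟩
    by_cases hne : i = k
    · exact ⟨C, hne ▸ hC⟩
    have hAik : 0 < -A i k := neg_pos.mpr (lt_of_le_of_ne (hA i k hne) hik)
    refine ⟨(C * (|A k k| + |U k k|) + |Matrix.vecMul v U k|) / -A i k, fun ε hε hε1 => ?_⟩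
    rw [le_div_iff₀ hAik]
    have hr0 := (hr ε hε).1
    have h1 := congrFun (hmul ε hε) k
    rw [← Matrix.mulVec_transpose, mulVec_eq_diag_add] at h1
    have hoff : ∀ l ∈ Finset.univ.erase k, (A + ε • U).transpose k l * r ε l ≤ 0 := by
      intro l hl
      have hlk := Finset.ne_of_mem_erase hl
      refine mul_nonpos_of_nonpos_of_nonneg ?_ (hr0 l)
      exact add_nonpos (hA l k hlk) (mul_nonpos_of_nonneg_of_nonpos hε.le (hU l k hlk))
    have h2 := Finset.single_le_sum
      (f := fun l => -((A + ε • U).transpose k l * r ε l))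
      (fun l hl => neg_nonneg.mpr (hoff l hl))
      (Finset.mem_erase.mpr ⟨hne, Finset.mem_univ i⟩)
    simp only [Finset.sum_neg_distrib, Matrix.transpose_apply, Matrix.add_apply, Matrix.smul_apply,
      smul_eq_mul] at h1 h2
    have h3 : (A k k + ε * U k k) * r ε k ≤ C * (|A k k| + |U k k|) := by
      rw [mul_comm C]
      refine mul_le_mul (add_le_add (le_abs_self _) ?_) (hC ε hε hε1) (hr0 k) (by positivity)
      calc ε * U k k ≤ ε * |U k k| := mul_le_mul_of_nonneg_left (le_abs_self _) hε.le
        _ ≤ |U k k| := mul_le_of_le_one_left (abs_nonneg _) hε1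
    have h4 : ε * U i k * r ε i ≤ 0 :=
      mul_nonpos_of_nonpos_of_nonneg
        (mul_nonpos_of_nonneg_of_nonpos hε.le (hU i k hne)) (hr0 i)
    have h5 := neg_abs_le (Matrix.vecMul v U k)
    linarith
  have hbdd : ∀ i, Access A i j → ∃ C, ∀ ε, 0 < ε → ε ≤ 1 → r ε i ≤ C := by
    intro i hij
    induction hij using Relation.ReflTransGen.head_induction_on with
    | refl =>
      refine ⟨0, fun ε hε _ => (eq_zero_of_not_access hL hε (fun i hi => hvQ i fun hiQ => ?_)
        (hr ε hε).1 (hr ε hε).2 hj).le⟩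
      exact hi (hQ.1.access hq hiQ)
    | head h _ ih => exact hback _ _ h ih
  obtain ⟨C, hC⟩ := hbdd q hqj
  have hvq : 0 < v q := by
    simp only [v, hq, dif_pos]
    exact hy _
  have hden : 0 < v q + |C| + 1 := by positivity
  have hε : 0 < v q / (v q + |C| + 1) := div_pos hvq hden
  have h1 := (hlower _ hε q).trans
    (hC _ hε ((div_le_one hden).mpr (by linarith [abs_nonneg C])))
  rw [inv_div, div_mul_cancel₀ _ hvq.ne'] at h1
  linarith [le_abs_self C]

end

/-! ### Self-partitions -/

section

variable {n : ℕ} {X : Matrix (Fin n) (Fin n) ℝ}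

/-- A path of `X` cannot leave the initial segment that ends with a block of a partition for which
`X` is block lower triangular. -/
theorem Access.notMem_after {P : Finpartition (Finset.univ : Finset (Fin n))}
    (hP : IsOrderPreserving P) (hX : IsBlockLower X P) {B : Finset (Fin n)} (hB : B ∈ P.parts)
    {i j : Fin n} (hij : Access X i j) (hi : i ∉ after B) : j ∉ after B := by
  induction hij with
  | refl => exact hi
  | @tail k l _ hkl ih =>
    intro hl
    obtain ⟨C, hC, hkC⟩ := P.exists_mem (Finset.mem_univ k)
    refine hkl (hX C hC k hkC l fun c hc => ?_)
    by_cases hCB : C = B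
    · exact hl c (hCB ▸ hc)
    · rcases hP C hC B hB hCB with h | h
      · obtain ⟨b, hb⟩ := P.nonempty_of_mem_parts hB
        exact (h c hc b hb).trans (hl b hb)
      · exact absurd (fun b hb => h k hkC b hb) ih

theorem encompasses_lowerSelfPartition {A L U : Matrix (Fin n) (Fin n) ℝ} (hA : IsZMatrix A)
    (hL : IsGeneralMMatrix L) (hU : IsZMatrix U) (hfac : A = L * U) {S Q : Finset (Fin n)}
    (hS : IsSingularClass A S) (hQS : Q ⊆ S) (hQ : IsSingularClass L Q) :
    Encompasses (lowerSelfPartition L) (setF A S) := by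
  obtain ⟨hP, hLP⟩ := (isLeast_lowerSelfPartition L).1
  obtain ⟨q, hq⟩ := hQ.1.nonempty
  obtain ⟨B, hB, hμB⟩ := (lowerSelfPartition L).exists_mem
    (Finset.mem_univ (S.max' hS.1.nonempty))
  refine ⟨B, hB, fun l hl => ?_⟩
  obtain ⟨hl, j, hlj, s, hs, hsj⟩ := hl
  have hqj : Access L q j :=
    hQ.access_of_access_mul hA hL hU hfac hq ((hS.1.access (hQS hq) hs).trans hsj)
  have hqB : q ∉ after B := fun h =>
    (h _ hμB).not_ge (S.le_max' q (hQS hq))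
  by_contra hlB
  have hlt : S.max' hS.1.nonempty < l :=
    lt_of_le_of_ne (hl _ (S.max'_mem _)) fun h => hlB (h ▸ hμB)
  have hafter := mem_after_of_not_mem hP hB hμB hlB hlt
  exact hqj.notMem_after hP hLP hB hqB fun b hb => (hafter b hb).trans_le hlj

end

end BlockLU

theorem theorem3p4 {n : ℕ} (A L U : Matrix (Fin n) (Fin n) ℝ)
    (hA : BlockLU.IsMMatrix A) (hL : BlockLU.IsMMatrix L) (hU : BlockLU.IsMMatrix U)
    (hfac : A = L * U) :
    ∀ S : Finset (Fin n), BlockLU.IsSingularClass A S →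
      (∃ Q : Finset (Fin n), Q ⊆ S ∧
        (BlockLU.IsSingularClass L Q ∨ BlockLU.IsSingularClass U Q)) ∧
      (∀ Q : Finset (Fin n), Q ⊆ S → BlockLU.IsSingularClass L Q →
        BlockLU.Encompasses (BlockLU.lowerSelfPartition L) (BlockLU.setF A S)) ∧
      (∀ Q : Finset (Fin n), Q ⊆ S → BlockLU.IsSingularClass U Q →
        BlockLU.Encompasses (BlockLU.upperSelfPartition U) (BlockLU.setT A S)) := by
  intro S hS
  have hA' := hA.isGeneralMMatrix
  have hL' := hL.isGeneralMMatrix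
  have hU' := hU.isGeneralMMatrix
  refine ⟨BlockLU.exists_isSingularClass_subset hA'.isZMatrix hL' hU' hfac hS.2,
    fun Q hQS hQ => BlockLU.encompasses_lowerSelfPartition hA'.isZMatrix hL' hU'.isZMatrix hfac hS
      hQS hQ, fun Q hQS hQ => ?_⟩
  -- The upper half is the lower half for `Aᵀ = Uᵀ Lᵀ`.
  have hT : BlockLU.setT A S = BlockLU.setF A.transpose S := by
    simp only [BlockLU.setT, BlockLU.setF, BlockLU.access_transpose]
  rw [BlockLU.upperSelfPartition_eq_transpose, hT]
  exact BlockLU.encompasses_lowerSelfPartition hA'.isZMatrix.transpose hU'.transpose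
    hL'.isZMatrix.transpose (by rw [hfac, Matrix.transpose_mul])
    (BlockLU.isSingularClass_transpose.mpr hS) hQS (BlockLU.isSingularClass_transpose.mpr hQ)
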